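/- Consider the $K$-armed stochastic bandit problem with arm distributions $\nu=(\nu_1,\dots,\nu_K)$ on $[0,1]$ with means $\mu_a=\mathbb{E}[\nu_a]$; put $\mu^*=\max_a\mu_a$ and $\Delta_a=\mu^*-\mu_a$. A (possibly randomized) strategy selects in each round $t$ an arm $a_t$ on the basis of the past arms and rewards $a_1,X_1,\dots,a_{t-1},X_{t-1}$; given $a_t$ and the past, the reward $X_t$ has law $\nu_{a_t}$. Let $N_k(T+1)=\sum_{t=1}^T\mathbf 1\{a_t=k\}$. For $\epsilon\in[0,1]$, an $\epsilon$-gap function is a function $f:[0,1]\to[0,\infty)$ with $f(x)=0$ for $x\in[0,\epsilon]$ and $f(x)>0$ for $x\in(\epsilon,1]$, and the lenient regret is $R_f(T)=\mathbb{E}\bigl[\sum_{t=1}^T f(\Delta_{a_t})\bigr]$. Let $\mathcal{D}$ be a set of probability distributions on $[0,1]$. A strategy is consistent over $\mathcal{D}$ w.r.t. $f$ if $R_f(T)=o(T^\alpha)$ as $T\to\infty$ for every $0<\alpha\le 1$ and every $K$-armed bandit problem whose arm distributions all lie in $\mathcal{D}$. Let $\mathcal{K}_{\inf}(\nu,x,\mathcal{D})=\inf\{\mathrm{KL}(\nu,\nu'):\nu'\in\mathcal{D},\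 \mathbb{E}[\nu']>x\}\in[0,\infty]$, where $\inf\emptyset=\infty$, and use the convention $c/\infty=0$. Theorem. Let $\epsilon\in[0,1]$, let $f$ be an $\epsilon$-gap function, and consider any strategy that is consistent over $\mathcal{D}$ w.r.t. $f$. Then for every bandit problem $\nu$ with $\nu_a\in\mathcal{D}$ for all $a$: 1. for every arm $k$ with $\Delta_k>\epsilon$, $$\liminf_{T\to\infty}\frac{\mathbb{E}[N_k(T+1)]}{\ln T}\ \ge\ \frac{1}{\mathcal{K}_{\inf}(\nu_k,\mu^*+\epsilon,\mathcal{D})};$$ 2. $$\liminf_{T\to\infty}\frac{R_f(T)}{\ln T}\ \ge\ \sum_{a:\Delta_a>\epsilon}\frac{f(\Delta_a)}{\mathcal{K}_{\inf}(\nu_a,\mu^*+\epsilon,\mathcal{D})};$$ 3. if $\mu^*>1-\epsilon$, then $\mathcal{K}_{\inf}(\nu_a,\mu^*+\epsilon,\mathcal{D})=\infty$ for every arm $a$, so the lower bound in (2) equals $0$ (that is, the lower bound is sub-logarithmic). -/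

import Mathlib

open MeasureTheory ProbabilityTheory

namespace LenientBandit

/-- Histories `(a_1, X_1, …, a_t, X_t)` of length `t` for `K` arms and rewards in `[0,1]`. -/
abbrev History (K t : ℕ) : Type := Fin t → Fin K × unitInterval

/-- A (randomized) bandit strategy with `K` arms: given the history of the first `t` rounds,
`policy t` is the distribution of the arm selected in round `t + 1`. -/
structure Strategy (K : ℕ) where
  policy : (t : ℕ) → Kernel (History K t) (Fin K)
  markov : ∀ t, IsMarkovKernel (policy t)

attribute [instance] Strategy.markov

/-- A bandit problem with `K` arms: one distribution on `[0,1]` for each arm. -/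
abbrev Problem (K : ℕ) : Type := Fin K → ProbabilityMeasure unitInterval

/-- The reward distribution as a kernel of the selected arm. -/
noncomputable def rewardKernel {K : ℕ} (ν : Problem K) : Kernel (Fin K) unitInterval where
  toFun a := (ν a : Measure unitInterval)
  measurable' := measurable_of_countable _

instance {K : ℕ} (ν : Problem K) : IsMarkovKernel (rewardKernel ν) :=
  ⟨fun a => inferInstanceAs (IsProbabilityMeasure (ν a : Measure unitInterval))⟩

/-- One round: an arm `a` is drawn from the policy given the past, then a reward is drawn
from `ν a`, conditionally independently of the past given `a`. -/
noncomputable def roundKernel {K : ℕ} (π : Strategy K) (ν : Problem K) (t : ℕ) :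
    Kernel (History K t) (Fin K × unitInterval) :=
  π.policy t ⊗ₖ Kernel.prodMkLeft (History K t) (rewardKernel ν)

instance {K : ℕ} (π : Strategy K) (ν : Problem K) (t : ℕ) :
    IsMarkovKernel (roundKernel π ν t) := by
  unfold roundKernel; infer_instance

/-- The law of `(a_1, X_1, …, a_T, X_T)` when the strategy `π` interacts with the problem `ν`. -/
noncomputable def historyLaw {K : ℕ} (π : Strategy K) (ν : Problem K) :
    (T : ℕ) → Measure (History K T)
  | 0 => Measure.dirac Fin.elim0
  | T + 1 => (historyLaw π ν T ⊗ₘ roundKernel π ν T).map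
      (fun p => (Fin.snoc p.1 p.2 : History K (T + 1)))

theorem measurable_snoc (K T : ℕ) :
    Measurable (fun p : History K T × (Fin K × unitInterval) =>
      (Fin.snoc p.1 p.2 : History K (T + 1))) := by
  refine measurable_pi_lambda _ fun i => ?_
  refine Fin.lastCases ?_ (fun j => ?_) i
  · simpa using measurable_snd
  · simp only [Fin.snoc_castSucc]
    exact (measurable_pi_apply j).comp measurable_fst

instance {K : ℕ} (π : Strategy K) (ν : Problem K) (T : ℕ) :
    IsProbabilityMeasure (historyLaw π ν T) := by
  induction T with
  | zero => unfold historyLaw; infer_instance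
  | succ T ih =>
    unfold historyLaw
    exact Measure.isProbabilityMeasure_map (measurable_snoc K T).aemeasurable

/-- The mean of a distribution on `[0,1]`. -/
noncomputable def mean (ν : ProbabilityMeasure unitInterval) : ℝ :=
  ∫ x, (x : ℝ) ∂(ν : Measure unitInterval)

/-- The mean `μ*` of an optimal arm. -/
noncomputable def bestMean {K : ℕ} (ν : Problem K) : ℝ := ⨆ a, mean (ν a)

/-- The suboptimality gap `Δ_a = μ* - μ_a`. -/
noncomputable def gap {K : ℕ} (ν : Problem K) (a : Fin K) : ℝ := bestMean ν - mean (ν a)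

/-- `f` is an `ε`-gap function; gaps lie in `[0,1]`, so only the values of `f` there matter. -/
def IsGapFunction (ε : ℝ) (f : ℝ → ℝ) : Prop :=
  (∀ x ∈ Set.Icc 0 ε, f x = 0) ∧ ∀ x ∈ Set.Ioc ε 1, 0 < f x

/-- The number of pulls of arm `k` along a history of `T` rounds, i.e. `N_k(T + 1)`. -/
def numPulls {K T : ℕ} (h : History K T) (k : Fin K) : ℕ :=
  (Finset.univ.filter fun t : Fin T => (h t).1 = k).card

/-- `E[N_k(T + 1)]`: the expected number of pulls of arm `k` in the first `T` rounds. -/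
noncomputable def expectedPulls {K : ℕ} (π : Strategy K) (ν : Problem K) (k : Fin K) (T : ℕ) : ℝ :=
  ∫ h, (numPulls h k : ℝ) ∂(historyLaw π ν T)

/-- The lenient regret `R_f(T) = E[∑_{t=1}^T f(Δ_{a_t})]`. -/
noncomputable def lenientRegret {K : ℕ} (f : ℝ → ℝ) (π : Strategy K) (ν : Problem K) (T : ℕ) : ℝ :=
  ∫ h, (∑ t : Fin T, f (gap ν (h t).1)) ∂(historyLaw π ν T)

/-- Consistency over `D` w.r.t. `f`: `R_f(T) = o(T^α)` for every `0 < α ≤ 1` and every bandit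
problem with arm distributions in `D`. -/
def IsConsistent {K : ℕ} (D : Set (ProbabilityMeasure unitInterval)) (f : ℝ → ℝ)
    (π : Strategy K) : Prop :=
  ∀ ν : Problem K, (∀ a, ν a ∈ D) → ∀ α : ℝ, 0 < α → α ≤ 1 →
    Asymptotics.IsLittleO Filter.atTop (fun T : ℕ => lenientRegret f π ν T)
      (fun T : ℕ => (T : ℝ) ^ α)

/-- `K_inf(ν, x, D) = inf {KL(ν, ν') : ν' ∈ D, E[ν'] > x}`, with `inf ∅ = ∞`. -/
noncomputable def Kinf (ν : ProbabilityMeasure unitInterval) (x : ℝ)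
    (D : Set (ProbabilityMeasure unitInterval)) : ENNReal :=
  ⨅ ν' ∈ {ν' ∈ D | x < mean ν'},
    InformationTheory.klDiv (ν : Measure unitInterval) (ν' : Measure unitInterval)

end LenientBandit

/-!
Replace the law of arm `k` by some `q ∈ D` with mean above `μ* + ε`. In the altered problem every
other arm has gap larger than `ε`, so consistency makes the strategy miss arm `k` only `o(T ^ α)`
times, for every `α > 0`. The two history laws have divergence `KL(ν_k, q) · E[N_k]`, because they
differ only in the rewards of `k`. If `E[N_k]` were small in the original problem, the fraction of
rounds missing `k` would have mean close to `1` under one law and at most `T ^ (α - 1)` under the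
other; Donsker–Varadhan with exponential parameter `(1 - α) log T` says that this costs a
divergence of about `(1 - α) log T`. Let `α → 0` and optimize over `q`. The bound on the regret
follows by superadditivity of the lower limit, and no `q` exists once `μ* + ε ≥ 1`.
-/

namespace LenientBandit

open InformationTheory Filter Topology
open scoped ENNReal

section Divergence

variable {α β : Type*} {mα : MeasurableSpace α} {mβ : MeasurableSpace β}

theorem klDiv_map_of_leftInverse (μ ν : Measure α) [IsFiniteMeasure μ] [IsFiniteMeasure ν]
    {f : α → β} {g : β → α} (hf : Measurable f) (hg : Measurable g)
    (hgf : Function.LeftInverse g f) :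
    klDiv (μ.map f) (ν.map f) = klDiv μ ν := by
  refine (klDiv_map_le μ ν hf).antisymm ?_
  have h := klDiv_map_le (μ.map f) (ν.map f) hg
  rwa [Measure.map_map hg hf, Measure.map_map hg hf, hgf.comp_eq_id, Measure.map_id,
    Measure.map_id] at h

section CompProd

variable [MeasurableSpace.CountableOrCountablyGenerated α β] (ρ : Measure α)
  (κ η : Kernel α β) [IsFiniteKernel κ] [IsFiniteKernel η]

theorem lintegral_klDiv_eq_top_of_not_ac (hac : ¬ ∀ᵐ a ∂ρ, κ a ≪ η a) :
    ∫⁻ a, klDiv (κ a) (η a) ∂ρ = ∞ := by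
  have hs : MeasurableSet {a | ¬ κ a ≪ η a} :=
    (Kernel.measurableSet_absolutelyContinuous κ η).compl
  refine top_unique ?_
  calc ∞ = ∫⁻ a, {a | ¬ κ a ≪ η a}.indicator (fun _ => ∞) a ∂ρ := by
        rw [lintegral_indicator_const hs, ENNReal.top_mul (mt ae_iff.2 hac)]
    _ ≤ ∫⁻ a, klDiv (κ a) (η a) ∂ρ :=
        lintegral_mono <| Set.indicator_le fun a ha => (klDiv_of_not_ac ha).ge

variable [IsFiniteMeasure ρ]

theorem rnDeriv_compProd_right (hac : ∀ᵐ a ∂ρ, κ a ≪ η a) :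
    (ρ ⊗ₘ κ).rnDeriv (ρ ⊗ₘ η) =ᵐ[ρ ⊗ₘ η] fun p => κ.rnDeriv η p.1 p.2 := by
  have hκ : κ =ᵐ[ρ] η.withDensity (κ.rnDeriv η) := by
    filter_upwards [hac] with a ha
    exact (Kernel.withDensity_rnDeriv_eq ha).symm
  rw [Measure.compProd_congr hκ, Measure.compProd_withDensity (Kernel.measurable_rnDeriv κ η)]
  exact Measure.rnDeriv_withDensity _ (Kernel.measurable_rnDeriv κ η)

theorem klDiv_compProd_right_of_ac (hac : ∀ᵐ a ∂ρ, κ a ≪ η a) :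
    klDiv (ρ ⊗ₘ κ) (ρ ⊗ₘ η) = ∫⁻ a, klDiv (κ a) (η a) ∂ρ := by
  have hmeas : Measurable fun p : α × β =>
      ENNReal.ofReal (klFun (κ.rnDeriv η p.1 p.2).toReal) :=
    (measurable_klFun.comp (Kernel.measurable_rnDeriv κ η).ennreal_toReal).ennreal_ofReal
  calc klDiv (ρ ⊗ₘ κ) (ρ ⊗ₘ η)
      = ∫⁻ p, ENNReal.ofReal (klFun ((ρ ⊗ₘ κ).rnDeriv (ρ ⊗ₘ η) p).toReal) ∂(ρ ⊗ₘ η) :=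
        klDiv_eq_lintegral_klFun_of_ac (Measure.AbsolutelyContinuous.compProd_right hac)
    _ = ∫⁻ p, ENNReal.ofReal (klFun (κ.rnDeriv η p.1 p.2).toReal) ∂(ρ ⊗ₘ η) := by
        refine lintegral_congr_ae ?_
        filter_upwards [rnDeriv_compProd_right ρ κ η hac] with p hp
        rw [hp]
    _ = ∫⁻ a, ∫⁻ b, ENNReal.ofReal (klFun (κ.rnDeriv η a b).toReal) ∂(η a) ∂ρ :=
        Measure.lintegral_compProd hmeas
    _ = ∫⁻ a, klDiv (κ a) (η a) ∂ρ := by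
        refine lintegral_congr_ae ?_
        filter_upwards [hac] with a ha
        rw [klDiv_eq_lintegral_klFun_of_ac ha]
        refine lintegral_congr_ae ?_
        filter_upwards [Kernel.rnDeriv_eq_rnDeriv_measure (κ := κ) (η := η) (a := a)] with b hb
        rw [hb]

theorem klDiv_compProd_right_eq_lintegral :
    klDiv (ρ ⊗ₘ κ) (ρ ⊗ₘ η) = ∫⁻ a, klDiv (κ a) (η a) ∂ρ := by
  by_cases hac : ∀ᵐ a ∂ρ, κ a ≪ η a
  · exact klDiv_compProd_right_of_ac ρ κ η hac
  · rw [lintegral_klDiv_eq_top_of_not_ac ρ κ η hac,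
      klDiv_of_not_ac (mt Measure.absolutelyContinuous_compProd_right_iff.1 hac)]

end CompProd

section ChangeOfMeasure

variable {P Q : Measure α} [IsProbabilityMeasure P] [IsProbabilityMeasure Q]

/-- Donsker–Varadhan: this is the nonnegativity of the divergence from `P` to the exponential
tilt of `Q` by `g`. -/
theorem integral_le_toReal_klDiv_add_log_integral_exp (hPQ : klDiv P Q ≠ ∞) {g : α → ℝ}
    (hgP : Integrable g P) (hgQ : Integrable (fun x => Real.exp (g x)) Q) :
    ∫ x, g x ∂P ≤ (klDiv P Q).toReal + Real.log (∫ x, Real.exp (g x) ∂Q) := by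
  obtain ⟨hac, hint⟩ := klDiv_ne_top_iff.1 hPQ
  have := isProbabilityMeasure_tilted hgQ
  have hnonneg := integral_llr_add_sub_measure_univ_nonneg
    (hac.trans (absolutelyContinuous_tilted hgQ)) (integrable_llr_tilted_right hac hgP hint hgQ)
  rw [integral_llr_tilted_right hac hgP hgQ hint] at hnonneg
  simp only [probReal_univ] at hnonneg
  rw [toReal_klDiv_of_measure_eq hac (by simp only [measure_univ])]
  linarith

theorem exp_mul_le_one_add_exp_sub_one_mul (l : ℝ) {z : ℝ} (hz : z ∈ Set.Icc (0 : ℝ) 1) :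
    Real.exp (l * z) ≤ 1 + (Real.exp l - 1) * z := by
  have h := rpow_one_add_le_one_add_mul_self (s := Real.exp l - 1)
    (by linarith [Real.exp_pos l]) hz.1 hz.2
  rwa [add_sub_cancel, ← Real.exp_mul, mul_comm z] at h

theorem mul_integral_le_toReal_klDiv_add_log (hPQ : klDiv P Q ≠ ∞) {z : α → ℝ}
    (hz : Measurable z) (hz01 : ∀ x, z x ∈ Set.Icc (0 : ℝ) 1) (l : ℝ) :
    l * ∫ x, z x ∂P ≤
      (klDiv P Q).toReal + Real.log (1 + (Real.exp l - 1) * ∫ x, z x ∂Q) := by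
  have hzint (R : Measure α) [IsProbabilityMeasure R] : Integrable z R :=
    .of_mem_Icc 0 1 hz.aemeasurable (.of_forall hz01)
  have hexp : Integrable (fun x => Real.exp (l * z x)) Q :=
    integrable_exp_mul_of_mem_Icc hz.aemeasurable (.of_forall hz01)
  have hmgf : ∫ x, Real.exp (l * z x) ∂Q ≤ 1 + (Real.exp l - 1) * ∫ x, z x ∂Q := by
    calc ∫ x, Real.exp (l * z x) ∂Q ≤ ∫ x, (1 + (Real.exp l - 1) * z x) ∂Q :=
          integral_mono hexp ((integrable_const 1).add ((hzint Q).const_mul _))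
            fun x => exp_mul_le_one_add_exp_sub_one_mul l (hz01 x)
      _ = 1 + (Real.exp l - 1) * ∫ x, z x ∂Q := by
          rw [integral_add (integrable_const 1) ((hzint Q).const_mul _), integral_const_mul,
            integral_const, probReal_univ, one_smul]
  calc l * ∫ x, z x ∂P = ∫ x, l * z x ∂P := (integral_const_mul l z).symm
    _ ≤ (klDiv P Q).toReal + Real.log (∫ x, Real.exp (l * z x) ∂Q) :=
        integral_le_toReal_klDiv_add_log_integral_exp hPQ ((hzint P).const_mul l) hexp
    _ ≤ (klDiv P Q).toReal + Real.log (1 + (Real.exp l - 1) * ∫ x, z x ∂Q) := by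
        gcongr
        exact integral_exp_pos hexp

end ChangeOfMeasure

end Divergence

section Asymptotics

theorem liminf_add_liminf_le_liminf_add {κ : Type*} (u v : κ → ℝ≥0∞) (F : Filter κ) :
    liminf u F + liminf v F ≤ liminf (fun n => u n + v n) F := by
  rw [liminf_eq, liminf_eq, sSup_eq_iSup, sSup_eq_iSup]
  refine ENNReal.biSup_add_biSup_le ⟨0, .of_forall fun _ => zero_le⟩
    ⟨0, .of_forall fun _ => zero_le⟩ fun a ha b hb => ?_
  exact le_liminf_of_le (by isBoundedDefault) ((ha.and hb).mono fun n h => add_le_add h.1 h.2)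

theorem sum_liminf_le_liminf_sum {ι κ : Type*} (s : Finset ι) (u : ι → κ → ℝ≥0∞) (F : Filter κ) :
    ∑ i ∈ s, liminf (u i) F ≤ liminf (fun n => ∑ i ∈ s, u i n) F := by
  classical
  induction s using Finset.induction_on with
  | empty => simp only [Finset.sum_empty, zero_le]
  | insert i s hi ih =>
    simp only [Finset.sum_insert hi]
    calc liminf (u i) F + ∑ j ∈ s, liminf (u j) F
        ≤ liminf (u i) F + liminf (fun n => ∑ j ∈ s, u j n) F := by gcongr
      _ ≤ liminf (fun n => u i n + ∑ j ∈ s, u j n) F := liminf_add_liminf_le_liminf_add _ _ F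

theorem rpow_one_sub_sub_one_mul_div_le_one {t r α : ℝ} (ht : 0 < t) (hr₀ : 0 ≤ r)
    (hr : r ≤ t ^ α) : (t ^ (1 - α) - 1) * (r / t) ≤ 1 := by
  have hpow : 0 < t ^ α := Real.rpow_pos_of_pos ht α
  calc (t ^ (1 - α) - 1) * (r / t) ≤ t ^ (1 - α) * (r / t) := by
        gcongr
        exact sub_le_self _ zero_le_one
    _ = r / t ^ α := by rw [Real.rpow_sub ht, Real.rpow_one]; field_simp
    _ ≤ 1 := (div_le_one hpow).2 hr

/-- The term `n T / T` need not vanish: the bound is solved for `n T / log T`, whose coefficient is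
`c + (1 - α) * (log T / T)`. -/
theorem ofReal_one_sub_div_le_liminf_div_log {c α : ℝ} (hc : 0 ≤ c) (hα : α < 1) {n : ℕ → ℝ}
    (h : ∀ᶠ T : ℕ in atTop,
      (1 - α) * Real.log T * (1 - n T / T) ≤ c * n T + Real.log 2) :
    ENNReal.ofReal (1 - α) / ENNReal.ofReal c ≤
      liminf (fun T : ℕ => ENNReal.ofReal (n T / Real.log T)) atTop := by
  have hnum : Tendsto (fun T : ℕ => 1 - α - Real.log 2 / Real.log T) atTop (𝓝 (1 - α)) := by
    have hlog := Real.tendsto_log_atTop.comp tendsto_natCast_atTop_atTop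
    simpa only [sub_zero, Function.comp_apply] using
      (hlog.const_div_atTop (Real.log 2)).const_sub (1 - α)
  have hden : Tendsto (fun T : ℕ => c + (1 - α) * (Real.log T / T)) atTop (𝓝 c) := by
    have hlog := Real.isLittleO_log_id_atTop.tendsto_div_nhds_zero.comp
      tendsto_natCast_atTop_atTop
    simpa only [mul_zero, add_zero, Function.comp_apply, id] using
      (hlog.const_mul (1 - α)).const_add c
  have hlim := ENNReal.Tendsto.div (ENNReal.tendsto_ofReal hnum)
    (.inl (ENNReal.ofReal_pos.2 (sub_pos.2 hα)).ne') (ENNReal.tendsto_ofReal hden)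
    (.inr ENNReal.ofReal_ne_top)
  rw [← hlim.liminf_eq]
  refine liminf_le_liminf ?_
  filter_upwards [h, eventually_gt_atTop 1] with T hT hT1
  have hlog : 0 < Real.log T := Real.log_pos (by exact_mod_cast hT1)
  refine ENNReal.div_le_of_le_mul ?_
  rw [← ENNReal.ofReal_mul' (by have := sub_pos.2 hα; positivity)]
  refine ENNReal.ofReal_le_ofReal ?_
  field_simp at hT ⊢
  linarith

theorem inv_ofReal_le_liminf_div_log {c : ℝ} (hc : 0 ≤ c) {n : ℕ → ℝ}
    (h : ∀ α : ℝ, 0 < α → α < 1 → ∀ᶠ T : ℕ in atTop,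
      (1 - α) * Real.log T * (1 - n T / T) ≤ c * n T + Real.log 2) :
    (ENNReal.ofReal c)⁻¹ ≤ liminf (fun T : ℕ => ENNReal.ofReal (n T / Real.log T)) atTop := by
  have hsub : Tendsto (fun α : ℝ => 1 - α) (𝓝[>] 0) (𝓝 1) :=
    tendsto_nhdsWithin_of_tendsto_nhds (by simpa using (continuous_sub_left (1 : ℝ)).tendsto 0)
  have hlim : Tendsto (fun α : ℝ => ENNReal.ofReal (1 - α) / ENNReal.ofReal c) (𝓝[>] 0)
      (𝓝 (ENNReal.ofReal c)⁻¹) := by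
    simpa using ENNReal.Tendsto.div_const (ENNReal.tendsto_ofReal hsub) (b := ENNReal.ofReal c)
      (.inl (by simp))
  refine le_of_tendsto hlim ?_
  filter_upwards [Ioo_mem_nhdsGT (zero_lt_one (α := ℝ))] with α hα
  exact ofReal_one_sub_div_le_liminf_div_log hc hα.2 (h α hα.1 hα.2)

end Asymptotics

variable {K : ℕ}

section Means

theorem mean_mem_Icc (p : ProbabilityMeasure unitInterval) : mean p ∈ Set.Icc (0 : ℝ) 1 := by
  have hint : Integrable (fun x : unitInterval => (x : ℝ)) (p : Measure unitInterval) :=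
    .of_mem_Icc 0 1 measurable_subtype_coe.aemeasurable (.of_forall fun x => x.2)
  refine ⟨integral_nonneg fun x => x.2.1, ?_⟩
  calc mean p ≤ ∫ _, (1 : ℝ) ∂(p : Measure unitInterval) :=
        integral_mono hint (integrable_const 1) fun x => x.2.2
    _ = 1 := by rw [integral_const, probReal_univ, one_smul]

theorem mean_le_bestMean (ν : Problem K) (a : Fin K) : mean (ν a) ≤ bestMean ν :=
  le_ciSup (f := fun a => mean (ν a)) (Set.finite_range _).bddAbove a

theorem gap_mem_Icc (ν : Problem K) (a : Fin K) : gap ν a ∈ Set.Icc (0 : ℝ) 1 := by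
  have hbest : bestMean ν ≤ 1 := Real.iSup_le (fun b => (mean_mem_Icc (ν b)).2) zero_le_one
  exact ⟨sub_nonneg.2 (mean_le_bestMean ν a),
    (sub_le_self _ (mean_mem_Icc (ν a)).1).trans hbest⟩

theorem lt_gap_update_of_ne {ε : ℝ} {ν : Problem K} {k : Fin K}
    {q : ProbabilityMeasure unitInterval} (hq : bestMean ν + ε < mean q) {a : Fin K}
    (ha : a ≠ k) : ε < gap (Function.update ν k q) a := by
  have hk : mean q ≤ bestMean (Function.update ν k q) := by
    simpa only [Function.update_self] using mean_le_bestMean (Function.update ν k q) k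
  rw [gap, Function.update_of_ne ha]
  linarith [mean_le_bestMean ν a]

theorem Kinf_eq_top_of_one_le {x : ℝ} (hx : 1 ≤ x) (p : ProbabilityMeasure unitInterval)
    (D : Set (ProbabilityMeasure unitInterval)) : Kinf p x D = ∞ :=
  iInf₂_eq_top.2 fun q hq => absurd (hq.2.trans_le (mean_mem_Icc q).2) hx.not_gt

theorem IsGapFunction.nonneg {ε : ℝ} {f : ℝ → ℝ} (hf : IsGapFunction ε f) :
    ∀ x ∈ Set.Icc (0 : ℝ) 1, 0 ≤ f x := by
  intro x hx
  rcases le_or_gt x ε with h | h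
  · exact (hf.1 x ⟨hx.1, h⟩).ge
  · exact (hf.2 x ⟨h, hx.2⟩).le

end Means

section Pulls

theorem numPulls_le {T : ℕ} (h : History K T) (k : Fin K) : numPulls h k ≤ T :=
  (Finset.card_filter_le _ _).trans_eq (Finset.card_fin T)

theorem numPulls_snoc {T : ℕ} (h : History K T) (p : Fin K × unitInterval) (k : Fin K) :
    numPulls (Fin.snoc h p : History K (T + 1)) k = numPulls h k + if p.1 = k then 1 else 0 := by
  simp only [numPulls, Finset.card_filter, Fin.sum_univ_castSucc, Fin.snoc_castSucc, Fin.snoc_last]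

theorem sum_arms_eq_sum_numPulls_mul {T : ℕ} (h : History K T) (g : Fin K → ℝ) :
    ∑ t, g (h t).1 = ∑ a, g a * numPulls h a := by
  simp only [numPulls, Finset.card_filter, Nat.cast_sum, Nat.cast_ite, Finset.mul_sum]
  rw [Finset.sum_comm]
  simp

theorem measurable_numPulls (T : ℕ) (k : Fin K) :
    Measurable fun h : History K T => numPulls h k := by
  simp only [numPulls, Finset.card_filter]
  have hk : Measurable fun a : Fin K => if a = k then 1 else 0 := measurable_of_countable _
  exact Finset.measurable_sum _ fun t _ => hk.comp (measurable_pi_apply t).fst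

variable (π : Strategy K) (ν : Problem K) (T : ℕ)

theorem integrable_numPulls (k : Fin K) :
    Integrable (fun h => (numPulls h k : ℝ)) (historyLaw π ν T) :=
  .of_mem_Icc 0 T (measurable_from_top.comp (measurable_numPulls T k)).aemeasurable
    (.of_forall fun h => ⟨Nat.cast_nonneg _, Nat.cast_le.2 (numPulls_le h k)⟩)

theorem expectedPulls_nonneg (k : Fin K) : 0 ≤ expectedPulls π ν k T :=
  integral_nonneg fun _ => Nat.cast_nonneg _

theorem integral_sum_arms (g : Fin K → ℝ) :
    ∫ h, ∑ t, g (h t).1 ∂historyLaw π ν T = ∑ a, g a * expectedPulls π ν a T := by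
  simp only [sum_arms_eq_sum_numPulls_mul]
  rw [integral_finsetSum _ fun a _ => (integrable_numPulls π ν T a).const_mul _]
  simp only [integral_const_mul, expectedPulls]

theorem sum_expectedPulls : ∑ a, expectedPulls π ν a T = T := by
  simpa using (integral_sum_arms π ν T 1).symm

theorem lenientRegret_eq_sum (f : ℝ → ℝ) :
    lenientRegret f π ν T = ∑ a, f (gap ν a) * expectedPulls π ν a T :=
  integral_sum_arms π ν T fun a => f (gap ν a)

theorem ofReal_expectedPulls (k : Fin K) :
    ENNReal.ofReal (expectedPulls π ν k T) = ∫⁻ h, (numPulls h k : ℝ≥0∞) ∂historyLaw π ν T := by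
  rw [expectedPulls, ofReal_integral_eq_lintegral_ofReal (integrable_numPulls π ν T k)
    (.of_forall fun h => Nat.cast_nonneg _)]
  simp only [ENNReal.ofReal_natCast]

theorem lintegral_roundKernel_indicator_fst (h : History K T) (k : Fin K) :
    ∫⁻ p, (if p.1 = k then 1 else 0) ∂roundKernel π ν T h = π.policy T h {k} := by
  have hk : Measurable fun a : Fin K => (if a = k then 1 else 0 : ℝ≥0∞) := measurable_of_countable _
  calc ∫⁻ p, (if p.1 = k then 1 else 0) ∂roundKernel π ν T h
      = ∫⁻ a, (if a = k then 1 else 0) ∂(roundKernel π ν T).fst h :=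
        (Kernel.lintegral_fst _ h hk).symm
    _ = ∫⁻ a, ({k} : Set (Fin K)).indicator 1 a ∂π.policy T h := by
        rw [roundKernel, Kernel.fst_compProd]
        simp only [Set.indicator_apply, Set.mem_singleton_iff, Pi.one_apply]
    _ = π.policy T h {k} := lintegral_indicator_one (measurableSet_singleton k)

theorem ofReal_expectedPulls_succ (k : Fin K) :
    ENNReal.ofReal (expectedPulls π ν k (T + 1)) =
      ENNReal.ofReal (expectedPulls π ν k T) + ∫⁻ h, π.policy T h {k} ∂historyLaw π ν T := by
  have hN (T : ℕ) : Measurable fun h : History K T => (numPulls h k : ℝ≥0∞) :=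
    measurable_from_top.comp (measurable_numPulls T k)
  have hsnoc : Measurable fun p : History K T × (Fin K × unitInterval) =>
      (numPulls (Fin.snoc p.1 p.2 : History K (T + 1)) k : ℝ≥0∞) :=
    (hN (T + 1)).comp (measurable_snoc K T)
  simp only [ofReal_expectedPulls]
  rw [historyLaw, lintegral_map (hN _) (measurable_snoc K T),
    Measure.lintegral_compProd hsnoc, ← lintegral_add_left (hN T)]
  refine lintegral_congr fun h => ?_
  simp only [numPulls_snoc, Nat.cast_add, Nat.cast_ite, Nat.cast_one, Nat.cast_zero]
  rw [lintegral_add_left measurable_const, lintegral_const, measure_univ, mul_one,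
    lintegral_roundKernel_indicator_fst]

end Pulls

section HistoryDivergence

theorem roundKernel_apply (π : Strategy K) (ν : Problem K) (T : ℕ) (h : History K T) :
    roundKernel π ν T h = π.policy T h ⊗ₘ rewardKernel ν := by
  rw [roundKernel, Kernel.compProd_apply_eq_compProd_sectR]
  rfl

theorem klDiv_roundKernel (π : Strategy K) (ν ν' : Problem K) (T : ℕ) (h : History K T) :
    klDiv (roundKernel π ν T h) (roundKernel π ν' T h) =
      ∑ a, klDiv (ν a : Measure unitInterval) (ν' a) * π.policy T h {a} := by
  rw [roundKernel_apply, roundKernel_apply, klDiv_compProd_right_eq_lintegral, lintegral_fintype]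
  rfl

theorem klDiv_historyLaw_succ (π : Strategy K) (ν ν' : Problem K) (T : ℕ) :
    klDiv (historyLaw π ν (T + 1)) (historyLaw π ν' (T + 1)) =
      klDiv (historyLaw π ν T) (historyLaw π ν' T) +
        ∫⁻ h, klDiv (roundKernel π ν T h) (roundKernel π ν' T h) ∂historyLaw π ν T := by
  have hinv : Function.LeftInverse
      (fun h : History K (T + 1) => ((Fin.init h : History K T), h (Fin.last T)))
      (fun p => (Fin.snoc p.1 p.2 : History K (T + 1))) := fun p => by
    simp only [Fin.init_snoc, Fin.snoc_last]
  have hmeas : Measurable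
      fun h : History K (T + 1) => ((Fin.init h : History K T), h (Fin.last T)) :=
    (measurable_pi_lambda _ fun t => measurable_pi_apply t.castSucc).prodMk
      (measurable_pi_apply (Fin.last T))
  rw [historyLaw, historyLaw, klDiv_map_of_leftInverse _ _ (measurable_snoc K T) hmeas hinv,
    klDiv_compProd_eq_add, klDiv_compProd_right_eq_lintegral]

theorem klDiv_historyLaw (π : Strategy K) (ν ν' : Problem K) (T : ℕ) :
    klDiv (historyLaw π ν T) (historyLaw π ν' T) =
      ∑ a, klDiv (ν a : Measure unitInterval) (ν' a) *
        ENNReal.ofReal (expectedPulls π ν a T) := by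
  induction T with
  | zero => simp [historyLaw, expectedPulls, numPulls]
  | succ T ih =>
    have hpolicy (a : Fin K) : Measurable fun h => π.policy T h {a} :=
      (π.policy T).measurable_coe (measurableSet_singleton a)
    simp only [klDiv_historyLaw_succ, ih, klDiv_roundKernel, ofReal_expectedPulls_succ, mul_add,
      Finset.sum_add_distrib]
    rw [lintegral_finsetSum _ fun a _ => (hpolicy a).const_mul _]
    simp only [lintegral_const_mul _ (hpolicy _)]

theorem klDiv_historyLaw_update (π : Strategy K) (ν : Problem K) (k : Fin K)
    (q : ProbabilityMeasure unitInterval) (T : ℕ) :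
    klDiv (historyLaw π ν T) (historyLaw π (Function.update ν k q) T) =
      klDiv (ν k : Measure unitInterval) q * ENNReal.ofReal (expectedPulls π ν k T) := by
  rw [klDiv_historyLaw, Finset.sum_eq_single_of_mem k (Finset.mem_univ k), Function.update_self]
  intro a _ ha
  rw [Function.update_of_ne ha, klDiv_self, zero_mul]

theorem mul_one_sub_expectedPulls_div_le (π : Strategy K) (ν ν' : Problem K) (T : ℕ)
    (hνν' : klDiv (historyLaw π ν T) (historyLaw π ν' T) ≠ ∞) (k : Fin K) (l : ℝ) :
    l * (1 - expectedPulls π ν k T / T) ≤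
      (klDiv (historyLaw π ν T) (historyLaw π ν' T)).toReal +
        Real.log (1 + (Real.exp l - 1) * (1 - expectedPulls π ν' k T / T)) := by
  have hz : Measurable fun h : History K T => 1 - (numPulls h k : ℝ) / T :=
    ((measurable_from_top.comp (measurable_numPulls T k)).div_const _).const_sub _
  have hz01 (h : History K T) : 1 - (numPulls h k : ℝ) / T ∈ Set.Icc (0 : ℝ) 1 :=
    ⟨sub_nonneg.2 (div_le_one_of_le₀ (Nat.cast_le.2 (numPulls_le h k)) T.cast_nonneg),
      sub_le_self _ (by positivity)⟩
  have hmean (ν : Problem K) :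
      ∫ h, (1 - (numPulls h k : ℝ) / T) ∂historyLaw π ν T = 1 - expectedPulls π ν k T / T := by
    rw [integral_sub (integrable_const 1) ((integrable_numPulls π ν T k).div_const _),
      integral_div, integral_const, probReal_univ, one_smul, expectedPulls]
  simpa only [hmean] using mul_integral_le_toReal_klDiv_add_log hνν' hz hz01 l

end HistoryDivergence

section LowerBound

variable {ε : ℝ} {f : ℝ → ℝ} {D : Set (ProbabilityMeasure unitInterval)} {π : Strategy K}
  {ν : Problem K}

theorem mul_expectedPulls_le_lenientRegret (hf : ∀ x ∈ Set.Icc (0 : ℝ) 1, 0 ≤ f x)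
    (π : Strategy K) (ν : Problem K) (k : Fin K) (T : ℕ) :
    f (gap ν k) * expectedPulls π ν k T ≤ lenientRegret f π ν T := by
  rw [lenientRegret_eq_sum]
  exact Finset.single_le_sum (f := fun a => f (gap ν a) * expectedPulls π ν a T)
    (fun a _ => mul_nonneg (hf _ (gap_mem_Icc ν a)) (expectedPulls_nonneg π ν T a))
    (Finset.mem_univ k)

theorem IsConsistent.isLittleO_expectedPulls (hπ : IsConsistent D f π)
    (hf : ∀ x ∈ Set.Icc (0 : ℝ) 1, 0 ≤ f x) (hν : ∀ a, ν a ∈ D) {k : Fin K}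
    (hk : 0 < f (gap ν k)) {α : ℝ} (hα₀ : 0 < α) (hα₁ : α ≤ 1) :
    (fun T : ℕ => expectedPulls π ν k T) =o[atTop] fun T : ℕ => (T : ℝ) ^ α := by
  refine Asymptotics.IsBigO.trans_isLittleO (.of_bound (f (gap ν k))⁻¹ (.of_forall fun T => ?_))
    (hπ ν hν α hα₀ hα₁)
  rw [Real.norm_of_nonneg (expectedPulls_nonneg π ν T k), inv_mul_eq_div, le_div_iff₀ hk,
    mul_comm]
  exact (mul_expectedPulls_le_lenientRegret hf π ν k T).trans (le_abs_self _)

theorem sub_expectedPulls_eq_sum_erase (π : Strategy K) (ν : Problem K) (k : Fin K) (T : ℕ) :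
    T - expectedPulls π ν k T = ∑ a ∈ Finset.univ.erase k, expectedPulls π ν a T := by
  rw [← sum_expectedPulls π ν T, ← Finset.add_sum_erase _ _ (Finset.mem_univ k),
    add_sub_cancel_left]

theorem IsConsistent.isLittleO_sub_expectedPulls (hπ : IsConsistent D f π)
    (hf : ∀ x ∈ Set.Icc (0 : ℝ) 1, 0 ≤ f x) (hν : ∀ a, ν a ∈ D) {k : Fin K}
    (hk : ∀ a, a ≠ k → 0 < f (gap ν a)) {α : ℝ} (hα₀ : 0 < α) (hα₁ : α ≤ 1) :
    (fun T : ℕ => T - expectedPulls π ν k T) =o[atTop] fun T : ℕ => (T : ℝ) ^ α := by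
  simp only [sub_expectedPulls_eq_sum_erase]
  rw [← Finset.sum_fn]
  exact Asymptotics.IsLittleO.sum fun a ha =>
    hπ.isLittleO_expectedPulls hf hν (hk a (Finset.ne_of_mem_erase ha)) hα₀ hα₁

/-- Change of measure with `l = (1 - α) * log T`, the largest choice for which the exponential
moment stays bounded when `k` is missed at most `T ^ α` times in the second problem. -/
theorem eventually_mul_log_mul_le {ν' : Problem K} {k : Fin K} {α : ℝ} (hα : α ≤ 1)
    (hνν' : ∀ T, klDiv (historyLaw π ν T) (historyLaw π ν' T) ≠ ∞)
    (hk : (fun T : ℕ => T - expectedPulls π ν' k T) =o[atTop] fun T : ℕ => (T : ℝ) ^ α) :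
    ∀ᶠ T : ℕ in atTop, (1 - α) * Real.log T * (1 - expectedPulls π ν k T / T) ≤
      (klDiv (historyLaw π ν T) (historyLaw π ν' T)).toReal + Real.log 2 := by
  filter_upwards [hk.def one_pos, eventually_ge_atTop 1] with T hT hT1
  have hT1' : (1 : ℝ) ≤ T := by exact_mod_cast hT1
  have hT0 : (0 : ℝ) < T := one_pos.trans_le hT1'
  have hmiss : T - expectedPulls π ν' k T ≤ (T : ℝ) ^ α := by
    rw [one_mul, Real.norm_of_nonneg (Real.rpow_nonneg hT0.le α)] at hT
    exact (le_abs_self _).trans hT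
  have hmiss₀ : 0 ≤ T - expectedPulls π ν' k T := by
    rw [sub_expectedPulls_eq_sum_erase]
    exact Finset.sum_nonneg fun a _ => expectedPulls_nonneg π ν' T a
  have hexp : Real.exp ((1 - α) * Real.log T) = (T : ℝ) ^ (1 - α) := by
    rw [Real.rpow_def_of_pos hT0, mul_comm]
  have hfrac : 1 - expectedPulls π ν' k T / T = (T - expectedPulls π ν' k T) / T := by
    rw [sub_div, div_self hT0.ne']
  refine (mul_one_sub_expectedPulls_div_le π ν ν' T (hνν' T) k _).trans ?_
  rw [hexp, hfrac]
  have hone : 1 ≤ (T : ℝ) ^ (1 - α) := Real.one_le_rpow hT1' (sub_nonneg.2 hα)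
  have hle := rpow_one_sub_sub_one_mul_div_le_one hT0 hmiss₀ hmiss
  have hnonneg := mul_nonneg (sub_nonneg.2 hone) (div_nonneg hmiss₀ hT0.le)
  exact add_le_add_right (Real.log_le_log (by linarith) (by linarith)) _

theorem inv_klDiv_le_liminf_expectedPulls (hπ : IsConsistent D f π)
    (hf₀ : ∀ x ∈ Set.Icc (0 : ℝ) 1, 0 ≤ f x) (hf₁ : ∀ x ∈ Set.Ioc ε 1, 0 < f x)
    (hν : ∀ a, ν a ∈ D) (k : Fin K) {q : ProbabilityMeasure unitInterval} (hqD : q ∈ D)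
    (hq : bestMean ν + ε < mean q) :
    (klDiv (ν k : Measure unitInterval) q)⁻¹ ≤
      liminf (fun T : ℕ => ENNReal.ofReal (expectedPulls π ν k T / Real.log T)) atTop := by
  by_cases htop : klDiv (ν k : Measure unitInterval) q = ∞
  · simp only [htop, ENNReal.inv_top, zero_le]
  set ν' := Function.update ν k q
  have hν' (a : Fin K) : ν' a ∈ D := Function.forall_update_iff ν (p := fun _ p => p ∈ D) |>.2
    ⟨hqD, fun a _ => hν a⟩ a
  have hgap (a : Fin K) (ha : a ≠ k) : 0 < f (gap ν' a) :=
    hf₁ _ ⟨lt_gap_update_of_ne hq ha, (gap_mem_Icc ν' a).2⟩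
  have hfin (T : ℕ) : klDiv (historyLaw π ν T) (historyLaw π ν' T) ≠ ∞ := by
    rw [klDiv_historyLaw_update]
    exact ENNReal.mul_ne_top htop ENNReal.ofReal_ne_top
  rw [← ENNReal.ofReal_toReal htop]
  refine inv_ofReal_le_liminf_div_log ENNReal.toReal_nonneg fun α hα₀ hα₁ => ?_
  simpa only [ν', klDiv_historyLaw_update, ENNReal.toReal_mul,
    ENNReal.toReal_ofReal (expectedPulls_nonneg π ν _ k)] using
    eventually_mul_log_mul_le hα₁.le hfin
      (hπ.isLittleO_sub_expectedPulls hf₀ hν' hgap hα₀ hα₁.le)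

theorem inv_Kinf_le_liminf_expectedPulls (hπ : IsConsistent D f π)
    (hf₀ : ∀ x ∈ Set.Icc (0 : ℝ) 1, 0 ≤ f x) (hf₁ : ∀ x ∈ Set.Ioc ε 1, 0 < f x)
    (hν : ∀ a, ν a ∈ D) (k : Fin K) :
    (Kinf (ν k) (bestMean ν + ε) D)⁻¹ ≤
      liminf (fun T : ℕ => ENNReal.ofReal (expectedPulls π ν k T / Real.log T)) atTop := by
  simp only [Kinf, ENNReal.inv_iInf]
  exact iSup₂_le fun q hq => inv_klDiv_le_liminf_expectedPulls hπ hf₀ hf₁ hν k hq.1 hq.2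

theorem ofReal_lenientRegret_div_log (hf : ∀ x ∈ Set.Icc (0 : ℝ) 1, 0 ≤ f x) (π : Strategy K)
    (ν : Problem K) (T : ℕ) :
    ENNReal.ofReal (lenientRegret f π ν T / Real.log T) =
      ∑ a, ENNReal.ofReal (f (gap ν a)) *
        ENNReal.ofReal (expectedPulls π ν a T / Real.log T) := by
  have hgap (a : Fin K) : 0 ≤ f (gap ν a) := hf _ (gap_mem_Icc ν a)
  have hrate (a : Fin K) : 0 ≤ expectedPulls π ν a T / Real.log T :=
    div_nonneg (expectedPulls_nonneg π ν T a) (Real.log_natCast_nonneg T)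
  simp only [lenientRegret_eq_sum, Finset.sum_div, mul_div_assoc, ← ENNReal.ofReal_mul (hgap _)]
  exact ENNReal.ofReal_sum_of_nonneg fun a _ => mul_nonneg (hgap a) (hrate a)

theorem sum_div_Kinf_le_liminf_lenientRegret (hπ : IsConsistent D f π)
    (hf₀ : ∀ x ∈ Set.Icc (0 : ℝ) 1, 0 ≤ f x) (hf₁ : ∀ x ∈ Set.Ioc ε 1, 0 < f x)
    (hν : ∀ a, ν a ∈ D) :
    ∑ a, ENNReal.ofReal (f (gap ν a)) / Kinf (ν a) (bestMean ν + ε) D ≤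
      liminf (fun T : ℕ => ENNReal.ofReal (lenientRegret f π ν T / Real.log T)) atTop := by
  simp only [ofReal_lenientRegret_div_log hf₀]
  refine le_trans (Finset.sum_le_sum fun a _ => ?_) (sum_liminf_le_liminf_sum _ _ _)
  rw [ENNReal.liminf_const_mul_of_ne_top ENNReal.ofReal_ne_top, div_eq_mul_inv]
  gcongr
  exact inv_Kinf_le_liminf_expectedPulls hπ hf₀ hf₁ hν a

end LowerBound

end LenientBandit

open LenientBandit Filter in
theorem mainTheorem3_general {K : ℕ} {ε : ℝ} {f : ℝ → ℝ}
    (hf₀ : ∀ x ∈ Set.Icc (0 : ℝ) 1, 0 ≤ f x) (hf₁ : ∀ x ∈ Set.Ioc ε 1, 0 < f x)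
    {D : Set (ProbabilityMeasure unitInterval)} {π : Strategy K} (hπ : IsConsistent D f π)
    {ν : Problem K} (hν : ∀ a, ν a ∈ D) :
    (∀ k, 1 / Kinf (ν k) (bestMean ν + ε) D ≤
      liminf (fun T : ℕ => ENNReal.ofReal (expectedPulls π ν k T / Real.log T)) atTop) ∧
    (∑ a, ENNReal.ofReal (f (gap ν a)) / Kinf (ν a) (bestMean ν + ε) D ≤
      liminf (fun T : ℕ => ENNReal.ofReal (lenientRegret f π ν T / Real.log T)) atTop) ∧
    (1 - ε ≤ bestMean ν → ∀ a, Kinf (ν a) (bestMean ν + ε) D = ⊤) := by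
  simp only [one_div]
  exact ⟨inv_Kinf_le_liminf_expectedPulls hπ hf₀ hf₁ hν,
    sum_div_Kinf_le_liminf_lenientRegret hπ hf₀ hf₁ hν,
    fun hbest a => Kinf_eq_top_of_one_le (sub_le_iff_le_add.1 hbest) (ν a) D⟩

theorem mainTheorem3 {K : ℕ} (ε : ℝ) (hε : ε ∈ Set.Icc (0 : ℝ) 1)
    (f : ℝ → ℝ) (hf : LenientBandit.IsGapFunction ε f)
    (D : Set (MeasureTheory.ProbabilityMeasure unitInterval))
    (π : LenientBandit.Strategy K) (hπ : LenientBandit.IsConsistent D f π)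
    (ν : LenientBandit.Problem K) (hν : ∀ a, ν a ∈ D) :
    (∀ k : Fin K, ε < LenientBandit.gap ν k →
      1 / LenientBandit.Kinf (ν k) (LenientBandit.bestMean ν + ε) D ≤
        Filter.liminf (fun T : ℕ =>
          ENNReal.ofReal (LenientBandit.expectedPulls π ν k T / Real.log T)) Filter.atTop) ∧
    (∑ a : Fin K with ε < LenientBandit.gap ν a,
        ENNReal.ofReal (f (LenientBandit.gap ν a)) /
          LenientBandit.Kinf (ν a) (LenientBandit.bestMean ν + ε) D ≤
      Filter.liminf (fun T : ℕ =>
        ENNReal.ofReal (LenientBandit.lenientRegret f π ν T / Real.log T)) Filter.atTop) ∧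
    (1 - ε < LenientBandit.bestMean ν →
      (∀ a : Fin K, LenientBandit.Kinf (ν a) (LenientBandit.bestMean ν + ε) D = ⊤) ∧
      ∑ a : Fin K with ε < LenientBandit.gap ν a,
        ENNReal.ofReal (f (LenientBandit.gap ν a)) /
          LenientBandit.Kinf (ν a) (LenientBandit.bestMean ν + ε) D = 0) := by
  obtain ⟨hpulls, hregret, htop⟩ := mainTheorem3_general hf.nonneg hf.2 hπ hν
  exact ⟨fun k _ => hpulls k,
    (Finset.sum_le_sum_of_subset (Finset.filter_subset _ _)).trans hregret,
    fun hbest => ⟨htop hbest.le,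
      by simp only [htop hbest.le, ENNReal.div_top, Finset.sum_const_zero]⟩⟩
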